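/- Let $n_0\ge 1$. There is a constant $c>0$, depending only on $n_0$, such that for every depth $L\ge 1$, every width $n\ge n_0$ and every output dimension $m\ge 1$ there is a rectifier network with $n_0$ inputs, $L$ hidden layers of $n$ units each and an affine output layer, i.e. a function $$F=f_{\rm out}\circ g\circ f_L\circ\cdots\circ g\circ f_1:\ \mathbb R^{n_0}\to\mathbb R^m$$ with affine maps $f_1:\mathbb R^{n_0}\to\mathbb R^n$, $f_2,\dots,f_L:\mathbb R^n\to\mathbb R^n$, $f_{\rm out}:\mathbb R^n\to\mathbb R^m$ and $g$ the coordinatewise map $t\mapsto\max\{0,t\}$, that has at least $$c\,\Big(\frac{n}{n_0}\Big)^{(L-1)n_0}\,n^{n_0}$$ linear regions. (In particular, for each fixed $n>n_0$ this lower bound grows exponentially in $L$.) Here a linear region of $F$ is a maximal connected subset of $\mathbb R^{n_0}$ on which $F$ coincides with an affine map, and which has full dimension (nonempty interior). -/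

import Mathlib

open scoped ENNReal Matrix

/-- The affine pre-activation map `x ↦ W x + b` with `k` inputs and `l` outputs. -/
structure AffineLayer (k l : ℕ) where
  /-- weight matrix -/
  W : Matrix (Fin l) (Fin k) ℝ
  /-- bias vector -/
  b : Fin l → ℝ

/-- The map `x ↦ W x + b`. -/
def AffineLayer.apply {k l : ℕ} (f : AffineLayer k l) (x : Fin k → ℝ) : Fin l → ℝ :=
  f.W *ᵥ x + f.b

/-- The rectifier activation `max {0, ·}`, applied to every coordinate. -/
def rectifier {l : ℕ} (y : Fin l → ℝ) : Fin l → ℝ := fun i => max 0 (y i)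

/-- `RectifierNetwork k ws m`: the parameters (weights and biases) of a rectifier network with `k`
inputs, hidden layers of widths `ws` (listed from the input to the output), and an affine output
map to `ℝ^m`. -/
inductive RectifierNetwork : ℕ → List ℕ → ℕ → Type
  | output {k m : ℕ} (f : AffineLayer k m) : RectifierNetwork k [] m
  | hidden {k w m : ℕ} {ws : List ℕ} (f : AffineLayer k w) (N : RectifierNetwork w ws m) :
      RectifierNetwork k (w :: ws) m

/-- The function `f_out ∘ g_L ∘ f_L ∘ ⋯ ∘ g_1 ∘ f_1` computed by a rectifier network. -/
def RectifierNetwork.eval {k m : ℕ} {ws : List ℕ} (N : RectifierNetwork k ws m) :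
    (Fin k → ℝ) → (Fin m → ℝ) :=
  match N with
  | .output f => f.apply
  | .hidden f N' => fun x => N'.eval (rectifier (f.apply x))

/-- `F` is linear (in the sense of affine) on `S`: it agrees on `S` with an affine map. -/
def IsAffineOn {k m : ℕ} (F : (Fin k → ℝ) → (Fin m → ℝ)) (S : Set (Fin k → ℝ)) : Prop :=
  ∃ A : (Fin k → ℝ) →ᵃ[ℝ] (Fin m → ℝ), Set.EqOn F A S

/-- A linear region of `F : ℝ^k → ℝ^m`: a subset of `ℝ^k` that is maximal among the connected
subsets on which `F` is linear, and that has full dimension `k` (nonempty interior). Without the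
last clause, `F (x, y) = |x|` would have spurious one-dimensional regions such as
`{(x, y) | t * y = |x|}`, where `F` agrees with the linear map `t * y`. -/
def IsLinearRegion {k m : ℕ} (F : (Fin k → ℝ) → (Fin m → ℝ)) (S : Set (Fin k → ℝ)) : Prop :=
  Maximal (fun T => IsConnected T ∧ IsAffineOn F T) S ∧ (interior S).Nonempty

/-- The number of linear regions of `F`. -/
noncomputable def numLinearRegions {k m : ℕ} (F : (Fin k → ℝ) → (Fin m → ℝ)) : ℕ∞ :=
  {S | IsLinearRegion F S}.encard

/-!
The network iterates a map `T` of the unit cube that folds the cube onto itself many times. Call an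
affine map `A` a full branch of `T` over the open cube `Q` if `A` is surjective, `A ⁻¹' Q ⊆ Q`, and
`T = A` on `A ⁻¹' Q`. Full branches of two maps compose to full branches of the composition, and
since branches are determined by their values on their open cells, distinct pairs have distinct
composites (`IsFullBranch.comp_inj`). Hence `K` full branches of `T` yield `K ^ L` full branches of
`T^[L]`. They are distinct affine maps, a generic linear functional keeps them distinct, and distinct
affine maps that agree with a function on open sets belong to distinct linear regions of it
(`card_le_numLinearRegions`). A map `T` that factors through a layer of `n` units is iterated `L`
times by `L` hidden layers of width `n` (`RectifierNetwork.exists_eval_eq_iterate`), so it remains to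
find a `T` with at least `(n / n₀) ^ n₀` full branches; then `c = n₀ ^ (-n₀)` works.

The map `T` acts on each coordinate separately. With `p ≥ 3` rectifier units one coordinate can be
folded `p + 1` times (`exists_reluSum_isFullBranch_of_three_le`), and with `p = 1, 2` units `p`
times. The gain of one fold makes up for rounding `n / n₀` down when `n ≥ 3 n₀`, and if
`2 n₀ ≤ n ≤ 3 n₀` it suffices to give two or three units to each coordinate. If `n₀ < n < 2 n₀`,
giving a unit to every coordinate would not always reach the exponential rate `(n / n₀) ^ n₀`: it is
better to fold only `⌊n / 2⌋` of the coordinates, with two or three units each, and to ignore the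
others. This gives `2 ^ ⌈n / 2⌉ ≥ (n / n₀) ^ n₀` branches (`exists_le_prod_foldCount`).
-/

/-! ### Affine pieces and linear regions -/

theorem AffineMap.ext_of_eqOn_isOpen {E F : Type*} [NormedAddCommGroup E] [NormedSpace ℝ E]
    [AddCommGroup F] [Module ℝ F] {A B : E →ᵃ[ℝ] F} {s : Set E} (hs : IsOpen s)
    (hne : s.Nonempty) (h : Set.EqOn A B s) : A = B :=
  AffineMap.ext_on (hs.affineSpan_eq_top hne) h

/-- If `F` agrees with `A` on a nonempty open set, then the connected components of `{x | F x = A x}`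
that have interior points are linear regions. Distinct affine maps give distinct regions, since `A`
is determined by its values on the interior of the region. -/
theorem card_le_numLinearRegions {k m : ℕ} {ι : Type*} [Fintype ι]
    {F : (Fin k → ℝ) → (Fin m → ℝ)} {A : ι → (Fin k → ℝ) →ᵃ[ℝ] (Fin m → ℝ)}
    (hA : Function.Injective A) (hF : ∀ i, (interior {x | F x = A i x}).Nonempty) :
    (Fintype.card ι : ℕ∞) ≤ numLinearRegions F := by
  choose x hx using hF
  set S : ι → Set (Fin k → ℝ) := fun i => connectedComponentIn {y | F y = A i y} (x i)
  have hmem (i) : x i ∈ {y | F y = A i y} := interior_subset (hx i)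
  have hSA (i) : Set.EqOn F (A i) (S i) := fun y hy =>
    connectedComponentIn_subset {y | F y = A i y} (x i) hy
  have hint (i) : (interior (S i)).Nonempty :=
    ⟨x i, mem_interior_iff_mem_nhds.2
      (connectedComponentIn_mem_nhds (mem_interior_iff_mem_nhds.1 (hx i)))⟩
  have huniq (i) (B : (Fin k → ℝ) →ᵃ[ℝ] (Fin m → ℝ)) (hB : Set.EqOn F B (S i)) : A i = B :=
    AffineMap.ext_of_eqOn_isOpen isOpen_interior (hint i) fun y hy =>
      (hSA i (interior_subset hy)).symm.trans (hB (interior_subset hy))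
  have hS : Function.Injective S := fun i j hij => hA (huniq i (A j) (hij ▸ hSA j))
  have hreg (i) : IsLinearRegion F (S i) := by
    refine ⟨⟨⟨isConnected_connectedComponentIn_iff.2 (hmem i), A i, hSA i⟩, ?_⟩, hint i⟩
    rintro T ⟨hT, B, hB⟩ hST
    obtain rfl := huniq i B (hB.mono hST)
    exact hT.isPreconnected.subset_connectedComponentIn (hST (mem_connectedComponentIn (hmem i))) hB
  calc (Fintype.card ι : ℕ∞) = (Set.range S).encard := by
        rw [← Set.image_univ, hS.encard_image, Set.encard_univ, ENat.card_eq_coe_fintype_card]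
    _ ≤ numLinearRegions F := Set.encard_le_encard (Set.range_subset_iff.2 hreg)

/-! ### Full branches of a self-map -/

/-- `A` is a full branch of `T` over `Q`: an affine map of the whole space that maps the cell
`A ⁻¹' Q`, contained in `Q`, onto `Q`, and that agrees with `T` on this cell. -/
def IsFullBranch {E : Type*} [NormedAddCommGroup E] [NormedSpace ℝ E] (Q : Set E) (T : E → E)
    (A : E →ᵃ[ℝ] E) : Prop :=
  Function.Surjective A ∧ ∀ x, A x ∈ Q → x ∈ Q ∧ T x = A x

section Branches

variable {E : Type*} [NormedAddCommGroup E] [NormedSpace ℝ E] {Q : Set E}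

theorem IsFullBranch.comp {S T : E → E} {A B : E →ᵃ[ℝ] E} (hA : IsFullBranch Q S A)
    (hB : IsFullBranch Q T B) : IsFullBranch Q (S ∘ T) (A.comp B) := by
  refine ⟨hA.1.comp hB.1, fun x hx => ?_⟩
  obtain ⟨h1, h2⟩ := hA.2 _ hx
  obtain ⟨h3, h4⟩ := hB.2 _ h1
  exact ⟨h3, by simp [h4, h2]⟩

/-- Distinct branches of `T` have disjoint cells, so the inner branch of a composition can be
recovered from the composite. -/
theorem IsFullBranch.comp_inj [FiniteDimensional ℝ E] (hQ : IsOpen Q) (hne : Q.Nonempty)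
    {S T : E → E} {A A' B B' : E →ᵃ[ℝ] E}
    (hA : IsFullBranch Q S A) (hA' : IsFullBranch Q S A') (hB : IsFullBranch Q T B)
    (hB' : IsFullBranch Q T B') (h : A.comp B = A'.comp B') : A = A' ∧ B = B' := by
  have hx (x : E) : A (B x) = A' (B' x) := DFunLike.congr_fun h x
  have hBB : B = B' := by
    refine AffineMap.ext_of_eqOn_isOpen
      (hQ.preimage (A.comp B).continuous_of_finiteDimensional) ?_ fun x hxQ => ?_
    · obtain ⟨q, hq⟩ := hne
      obtain ⟨x, rfl⟩ := hA.1.comp hB.1 q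
      exact ⟨x, hq⟩
    · have hxQ : A (B x) ∈ Q := hxQ
      rw [← (hB.2 x (hA.2 _ hxQ).1).2, (hB'.2 x (hA'.2 _ (hx x ▸ hxQ)).1).2]
  subst hBB
  refine ⟨?_, rfl⟩
  ext y
  obtain ⟨x, rfl⟩ := hB.1 y
  exact hx x

theorem exists_isFullBranch_iterate [FiniteDimensional ℝ E] (hQ : IsOpen Q) (hne : Q.Nonempty)
    {T : E → E} {ι : Type*} {B : ι → E →ᵃ[ℝ] E} (hinj : Function.Injective B)
    (hB : ∀ i, IsFullBranch Q T (B i)) (L : ℕ) :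
    ∃ A : (Fin L → ι) → E →ᵃ[ℝ] E,
      Function.Injective A ∧ ∀ w, IsFullBranch Q (T^[L]) (A w) := by
  induction L with
  | zero =>
    exact ⟨fun _ => AffineMap.id ℝ E, Function.injective_of_subsingleton _,
      fun _ => ⟨Function.surjective_id, fun x hx => ⟨hx, rfl⟩⟩⟩
  | succ L ih =>
    obtain ⟨A, hA, hAB⟩ := ih
    refine ⟨fun w => (A (Fin.tail w)).comp (B (w 0)), fun w w' h => ?_, fun w => ?_⟩
    · obtain ⟨h1, h2⟩ := IsFullBranch.comp_inj hQ hne (hAB _) (hAB _) (hB _) (hB _) h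
      rw [← Fin.cons_self_tail w, ← Fin.cons_self_tail w', hA h1, hinj h2]
    · rw [Function.iterate_succ]
      exact (hAB _).comp (hB _)

/-- Full branches of the factors of a product map combine freely. -/
theorem exists_isFullBranch_pi {κ : Type*} [Fintype κ] {ι : κ → Type*} {Q : Set ℝ}
    {h : κ → ℝ → ℝ} {B : ∀ i, ι i → ℝ →ᵃ[ℝ] ℝ} (hinj : ∀ i, Function.Injective (B i))
    (hB : ∀ i j, IsFullBranch Q (h i) (B i j)) :
    ∃ A : (∀ i, ι i) → (κ → ℝ) →ᵃ[ℝ] (κ → ℝ), Function.Injective A ∧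
      ∀ w, IsFullBranch (Set.univ.pi fun _ => Q) (fun x i => h i (x i)) (A w) := by
  refine ⟨fun w => AffineMap.pi fun i => (B i (w i)).comp (AffineMap.proj i),
    fun w w' e => ?_, fun w => ⟨fun y => ?_, fun x hx => ?_⟩⟩
  · funext i
    refine hinj i (AffineMap.ext fun t => ?_)
    simpa using congr_fun (DFunLike.congr_fun e fun _ => t) i
  · choose x hx using fun i => (hB i (w i)).1 (y i)
    exact ⟨x, funext hx⟩
  · have hi (i) := (hB i (w i)).2 (x i) (hx i trivial)
    exact ⟨fun i _ => (hi i).1, funext fun i => (hi i).2⟩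

end Branches

/-! ### Folding the unit interval with rectifier units -/

/-- The function of one variable computed by `p` rectifier units with incoming weights `u`,
biases `s`, outgoing weights `v` and output bias `c`. -/
def reluSum {p : ℕ} (u s v : Fin p → ℝ) (c t : ℝ) : ℝ :=
  c + ∑ j, v j * max 0 (u j * t + s j)

/-- The number of times that `p` rectifier units fold a line onto the unit interval. Three or more
units give one fold more than there are units. -/
def foldCount (p : ℕ) : ℕ := if p < 3 then p else p + 1

theorem isFullBranch_Ioo_iff {h : ℝ → ℝ} {a b : ℝ} (ha : a ≠ 0) :
    IsFullBranch (Set.Ioo 0 1) h (AffineMap.mk' (fun t : ℝ => a * t + b)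
      (LinearMap.mulLeft ℝ a) 0 (by simp)) ↔
    ∀ t, 0 < a * t + b → a * t + b < 1 → 0 < t ∧ t < 1 ∧ h t = a * t + b := by
  constructor
  · rintro h t h0 h1
    have := h.2 t ⟨h0, h1⟩
    exact ⟨this.1.1, this.1.2, this.2⟩
  · refine fun H => ⟨fun y => ⟨(y - b) / a, ?_⟩, fun t ht => ?_⟩
    · simp; field_simp; ring
    · obtain ⟨h0, h1, h2⟩ := H t ht.1 ht.2
      exact ⟨⟨h0, h1⟩, h2⟩

theorem exists_isFullBranch_of_lines {h : ℝ → ℝ} {ι : Type*} {a b : ι → ℝ} (ha : ∀ i, a i ≠ 0)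
    (hb : Function.Injective b)
    (H : ∀ i t, 0 < a i * t + b i → a i * t + b i < 1 → 0 < t ∧ t < 1 ∧ h t = a i * t + b i) :
    ∃ B : ι → ℝ →ᵃ[ℝ] ℝ,
      Function.Injective B ∧ ∀ i, IsFullBranch (Set.Ioo 0 1) h (B i) := by
  refine ⟨fun i => _, fun i j hij => hb ?_, fun i => (isFullBranch_Ioo_iff (ha i)).2 (H i)⟩
  simpa using DFunLike.congr_fun hij 0

/-- On `[k, k + 1]` the alternating sum of hinges with unit spacing is the zigzag with slopes
`±1`. -/
theorem zigzag_eq (k : ℕ) (y : ℝ) :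
    2 * y - 1 - 3 * (y - 1) + ∑ i ∈ Finset.range k, 2 * (-1 : ℝ) ^ i * (y - (i + 2)) =
      1 / 2 - (-1) ^ k * (y - (k + 1) - 1 / 2) := by
  induction k with
  | zero => simp; ring
  | succ k ih =>
    rw [Finset.sum_range_succ, ← add_assoc, ih]
    push_cast
    ring

theorem sum_hinge_eq {p k : ℕ} (hk : k ≤ p) {y : ℝ} (h1 : (k : ℝ) + 1 ≤ y)
    (h2 : y ≤ k + 2) :
    ∑ i ∈ Finset.range p, 2 * (-1 : ℝ) ^ i * max 0 (y - (i + 2)) =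
      ∑ i ∈ Finset.range k, 2 * (-1 : ℝ) ^ i * (y - (i + 2)) := by
  rw [← Finset.sum_range_add_sum_Ico _ hk, add_eq_left.2]
  · refine Finset.sum_congr rfl fun i hi => ?_
    have : (i : ℝ) + 1 ≤ k := by exact_mod_cast Finset.mem_range.1 hi
    rw [max_eq_right (by linarith)]
  · refine Finset.sum_eq_zero fun i hi => ?_
    rw [Finset.mem_Ico] at hi
    have : (k : ℝ) ≤ i := by exact_mod_cast hi.1
    rw [max_eq_left, mul_zero]
    linarith

/-- With `y = ((2 p + 1) t + 1) / 2` the fold is the function of slope `2` up to `y = 1` and of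
slopes `-1, 1, -1, …` between consecutive integers from there on. As a sum of hinges at
`y = 1, …, p` it has the extra linear term `2 y`, which is absorbed by reversing the hinge at
`y = 3`, whose weight is `-2`; that is why `3 ≤ p` is needed. -/
theorem exists_reluSum_isFullBranch_of_three_le {p : ℕ} (hp : 3 ≤ p) :
    ∃ (u s v : Fin p → ℝ) (c : ℝ) (B : Fin (p + 1) → ℝ →ᵃ[ℝ] ℝ), Function.Injective B ∧
      ∀ i, IsFullBranch (Set.Ioo 0 1) (reluSum u s v c) (B i) := by
  obtain ⟨q, rfl⟩ : ∃ q, p = q + 3 := ⟨p - 3, by omega⟩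
  set P : ℝ := 2 * ((q + 3 : ℕ) : ℝ) + 1 with hP
  have hP0 : 0 < P := by positivity
  let ε : ℕ → ℝ := fun j => if j = 2 then -1 else 1
  let w : ℕ → ℝ := fun j => if j = 0 then -3 else 2 * (-1) ^ (j + 1)
  let y : ℝ → ℝ := fun t => (P * t + 1) / 2
  set u : Fin (q + 3) → ℝ := fun j => ε j * (P / 2)
  set s : Fin (q + 3) → ℝ := fun j => ε j * (1 / 2 - (j + 1))
  set v : Fin (q + 3) → ℝ := fun j => w j
  have key (t : ℝ) : reluSum u s v 5 t = 2 * y t - 1 - 3 * max 0 (y t - 1) +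
      ∑ i ∈ Finset.range (q + 2), 2 * (-1 : ℝ) ^ i * max 0 (y t - (i + 2)) := by
    have hf (j : Fin (q + 3)) :
        v j * max 0 (u j * t + s j) = w j * max 0 (ε j * (y t - (j + 1))) := by
      simp only [u, s, v, y]; ring_nf
    -- the reversed hinge at `y = 3` is the usual one minus a linear function
    have hrev : max 0 (-1 * (y t - 3)) = max 0 (y t - 3) - (y t - 3) := by
      rcases le_total (y t) 3 with h | h
      · rw [max_eq_right (by linarith), max_eq_left (by linarith)]; ring
      · rw [max_eq_left (by linarith), max_eq_right (by linarith)]; ring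
    rw [reluSum, Finset.sum_congr rfl fun j _ => hf j,
      Fin.sum_univ_eq_sum_range (fun j : ℕ => w j * max 0 (ε j * (y t - (j + 1)))),
      Finset.sum_range_succ', Finset.sum_range_succ', Finset.sum_range_succ',
      Finset.sum_range_succ' _ (q + 1), Finset.sum_range_succ' _ q]
    have hs : ∀ i ∈ Finset.range q, w (i + 1 + 1 + 1) * max 0 (ε (i + 1 + 1 + 1) *
        (y t - (((i + 1 + 1 + 1 : ℕ) : ℝ) + 1))) =
        2 * (-1 : ℝ) ^ (i + 1 + 1) * max 0 (y t - (((i + 1 + 1 : ℕ) : ℝ) + 2)) := by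
      intro i _
      have h1 : ε (i + 1 + 1 + 1) = 1 := if_neg (by omega)
      have h2 : w (i + 1 + 1 + 1) = 2 * (-1) ^ (i + 1 + 1 + 1 + 1) := if_neg (by omega)
      rw [h1, h2]
      push_cast
      ring_nf
    rw [Finset.sum_congr rfl hs]
    have e0 : ε 0 = 1 := rfl
    have e1 : ε (0 + 1) = 1 := rfl
    have e2 : ε (0 + 1 + 1) = -1 := rfl
    have w0 : w 0 = -3 := rfl
    have w1 : w (0 + 1) = 2 * (-1) ^ (0 + 1 + 1) := rfl
    have w2 : w (0 + 1 + 1) = 2 * (-1) ^ (0 + 1 + 1 + 1) := rfl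
    rw [e0, e1, e2, w0, w1, w2]
    have hc2 : (((0 + 1 + 1 : ℕ) : ℝ) + 1) = 3 := by norm_num
    have hc1 : (((0 + 1 : ℕ) : ℝ) + 1) = 2 := by norm_num
    have hc3 : (((0 + 1 : ℕ) : ℝ) + 2) = 3 := by norm_num
    rw [hc2, hc1, hc3, hrev]
    simp
    ring
  -- branch `0` has slope `2` in `y`; branch `i + 1` lives on `i + 1 < y < i + 2`
  let a : Fin (q + 3 + 1) → ℝ := Fin.cons P fun i => -(-1) ^ (i : ℕ) * (P / 2)
  let b : Fin (q + 3 + 1) → ℝ :=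
    Fin.cons 0 fun i => 1 / 2 - (-1) ^ (i : ℕ) * (1 / 2 - (i + 1) - 1 / 2)
  have hsq (i : ℕ) : ((-1 : ℝ) ^ i) = 1 ∨ ((-1 : ℝ) ^ i) = -1 := neg_one_pow_eq_or ℝ i
  refine ⟨u, s, v, 5, exists_isFullBranch_of_lines (a := a) (b := b) ?_ ?_ ?_⟩
  · refine Fin.cases hP0.ne' fun i => ?_
    simp [a, hP0.ne']
  · have hb0 (i : Fin (q + 3)) : (0 : ℝ) ≠ 1 / 2 - (-1) ^ (i : ℕ) * (1 / 2 - (i + 1) - 1 / 2) := by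
      intro h
      have h' : (2 : ℝ) * ((i : ℕ) + 1) = 1 ∨ (2 : ℝ) * ((i : ℕ) + 1) = -1 := by
        rcases hsq i with e | e <;> rw [e] at h
        · right; linarith
        · left; linarith
      rcases h' with h' | h' <;> [skip; linarith [(i : ℕ).cast_nonneg (α := ℝ)]]
      have : 2 * ((i : ℕ) + 1) = 1 := by exact_mod_cast h'
      omega
    refine Fin.cons_injective_iff.2 ⟨fun ⟨i, hi⟩ => hb0 i hi.symm, fun i j hij => ?_⟩
    have hi0 := (i : ℕ).cast_nonneg (α := ℝ)
    have hj0 := (j : ℕ).cast_nonneg (α := ℝ)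
    have : ((i : ℕ) : ℝ) = (j : ℕ) := by
      simp only at hij
      rcases hsq i with e | e <;> rcases hsq j with e' | e' <;> rw [e, e'] at hij <;> linarith
    exact Fin.ext (by exact_mod_cast this)
  · refine Fin.cases (fun t h0 h1 => ?_) fun i t h0 h1 => ?_
    · have ha : a 0 = P := rfl
      have hb : b 0 = 0 := rfl
      rw [ha, hb, add_zero] at h0 h1 ⊢
      have hP1 : 1 ≤ P := by rw [hP]; linarith [(q + 3).cast_nonneg (α := ℝ)]
      have ht : 0 < t := pos_of_mul_pos_right h0 hP0.le
      refine ⟨ht, by nlinarith, ?_⟩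
      have hy : y t < 1 := by simp only [y]; linarith
      rw [key, max_eq_left (by linarith), Finset.sum_eq_zero]
      · simp only [y]; ring
      · intro i _
        rw [max_eq_left (by linarith [i.cast_nonneg (α := ℝ)]), mul_zero]
    · have hab : a i.succ * t + b i.succ =
          1 / 2 - (-1) ^ (i : ℕ) * (y t - ((i : ℕ) + 1) - 1 / 2) := by
        simp only [a, b, y, Fin.cons_succ]; ring
      rw [hab] at h0 h1 ⊢
      have hi0 := (i : ℕ).cast_nonneg (α := ℝ)
      have hi1 : ((i : ℕ) : ℝ) + 1 ≤ (q + 3 : ℕ) := by exact_mod_cast i.2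
      have hy : ((i : ℕ) : ℝ) + 1 < y t ∧ y t < (i : ℕ) + 2 := by
        rcases hsq i with e | e <;> rw [e] at h0 h1 <;> constructor <;> linarith
      have hyt : P * t = 2 * y t - 1 := by simp only [y]; ring
      refine ⟨pos_of_mul_pos_right (a := P) (by linarith) hP0.le, ?_, ?_⟩
      · by_contra! h
        have : P * 1 ≤ P * t := mul_le_mul_of_nonneg_left h hP0.le
        linarith
      · rw [key, max_eq_right (by linarith), sum_hinge_eq (k := i) (by omega) hy.1.le hy.2.le,
          zigzag_eq]

theorem exists_reluSum_isFullBranch (p : ℕ) :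
    ∃ (u s v : Fin p → ℝ) (c : ℝ) (B : Fin (foldCount p) → ℝ →ᵃ[ℝ] ℝ), Function.Injective B ∧
      ∀ i, IsFullBranch (Set.Ioo 0 1) (reluSum u s v c) (B i) := by
  match p with
  | 0 => exact ⟨0, 0, 0, 0, Fin.elim0, fun i => i.elim0, fun i => i.elim0⟩
  | 1 =>
    refine ⟨1, 0, 1, 0, exists_isFullBranch_of_lines (ι := Fin 1) (a := 1) (b := 0) (by simp)
      (Function.injective_of_subsingleton _) fun i t h0 h1 => ?_⟩
    simp at h0 h1
    simp [reluSum, h0, h1, h0.le]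
  | 2 =>
    -- the tent map
    refine ⟨![1, 1], ![0, -1 / 2], ![2, -4], 0, exists_isFullBranch_of_lines (ι := Fin 2)
      (a := ![2, -2]) (b := ![0, 2]) (by simp [Fin.forall_fin_two]) ?_ ?_⟩
    · simp [Function.Injective, Fin.forall_fin_two]
    · simp only [Fin.forall_fin_two, reluSum, Fin.sum_univ_two]
      refine ⟨fun t h0 h1 => ?_, fun t h0 h1 => ?_⟩ <;> simp at h0 h1 ⊢
      · refine ⟨h0, by linarith, ?_⟩
        rw [max_eq_right h0.le, max_eq_left (by linarith)]; ring
      · refine ⟨by linarith, by linarith, ?_⟩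
        rw [max_eq_right (by linarith), max_eq_right (by linarith)]; ring
  | p + 3 =>
    have h : foldCount (p + 3) = p + 3 + 1 := if_neg (by omega)
    rw [h]
    exact exists_reluSum_isFullBranch_of_three_le (by omega)

/-! ### Networks that iterate a map -/

/-- The affine layer computing `g ∘ f`. -/
def AffineLayer.comp {k l m : ℕ} (g : AffineLayer l m) (f : AffineLayer k l) : AffineLayer k m :=
  ⟨g.W * f.W, g.W *ᵥ f.b + g.b⟩

theorem AffineLayer.comp_apply {k l m : ℕ} (g : AffineLayer l m) (f : AffineLayer k l)
    (x : Fin k → ℝ) : (g.comp f).apply x = g.apply (f.apply x) := by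
  simp [AffineLayer.comp, AffineLayer.apply, Matrix.mulVec_add, add_assoc]

theorem RectifierNetwork.exists_eval_eq_comp_apply {k l m : ℕ} {ws : List ℕ}
    (N : RectifierNetwork l ws m) (f : AffineLayer k l) :
    ∃ N' : RectifierNetwork k ws m, N'.eval = N.eval ∘ f.apply := by
  cases N with
  | output g => exact ⟨.output (g.comp f), funext (g.comp_apply f)⟩
  | hidden g N =>
    refine ⟨.hidden (g.comp f) N, funext fun x => ?_⟩
    simp [RectifierNetwork.eval, g.comp_apply f]

/-- A map that factors through one layer of `n` rectifier units can be iterated `L` times by `L`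
hidden layers of width `n`: the readout of one step merges with the affine part of the next. -/
theorem RectifierNetwork.exists_eval_eq_iterate {d n m : ℕ} {T : (Fin d → ℝ) → (Fin d → ℝ)}
    (f : AffineLayer d n) (r : AffineLayer n d) (hT : ∀ x, r.apply (rectifier (f.apply x)) = T x)
    (g : AffineLayer d m) (L : ℕ) :
    ∃ N : RectifierNetwork d (List.replicate L n) m, N.eval = g.apply ∘ T^[L] := by
  induction L with
  | zero => exact ⟨.output g, rfl⟩
  | succ L ih =>
    obtain ⟨N, hN⟩ := ih
    obtain ⟨N', hN'⟩ := N.exists_eval_eq_comp_apply r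
    refine ⟨.hidden f N', funext fun x => ?_⟩
    simp [RectifierNetwork.eval, hN', hN, hT]

/-- A layer of `n` units can simulate any family `κ` of at most `n` units; the remaining units get
zero weights. -/
theorem exists_affineLayer_apply_rectifier {κ : Type*} [Fintype κ] {d e n : ℕ}
    (hκ : Fintype.card κ ≤ n) (U : κ → Fin d → ℝ) (s : κ → ℝ) (V : κ → Fin e → ℝ)
    (c : Fin e → ℝ) :
    ∃ (f : AffineLayer d n) (r : AffineLayer n e), ∀ x i,
      r.apply (rectifier (f.apply x)) i = c i + ∑ k, V k i * max 0 (U k ⬝ᵥ x + s k) := by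
  let φ : Fin n ≃ κ ⊕ Fin (n - Fintype.card κ) :=
    Fintype.equivOfCardEq (by simp; omega)
  refine ⟨⟨fun j => Sum.elim U 0 (φ j), fun j => Sum.elim s 0 (φ j)⟩,
    ⟨fun i j => Sum.elim (fun k => V k i) 0 (φ j), c⟩, fun x i => ?_⟩
  have h := φ.sum_comp fun z => Sum.elim (fun k => V k i) 0 z *
    max 0 (Sum.elim U 0 z ⬝ᵥ x + Sum.elim s 0 z)
  rw [Fintype.sum_sum_type] at h
  simp only [Sum.elim_inl, Sum.elim_inr, Pi.zero_apply, zero_mul, Finset.sum_const_zero,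
    add_zero] at h
  rw [← h, add_comm]
  rfl

/-- A layer of `n` units can apply `reluSum` functions to all coordinates at once, if they need at
most `n` units together. -/
theorem exists_affineLayer_apply_rectifier_eq_reluSum {d n : ℕ} {p : Fin d → ℕ}
    (hp : ∑ i, p i ≤ n) (u s v : ∀ i, Fin (p i) → ℝ) (c : Fin d → ℝ) :
    ∃ (f : AffineLayer d n) (r : AffineLayer n d), ∀ x,
      r.apply (rectifier (f.apply x)) = fun i => reluSum (u i) (s i) (v i) (c i) (x i) := by
  obtain ⟨f, r, h⟩ := exists_affineLayer_apply_rectifier (κ := Σ i, Fin (p i)) (by simpa using hp)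
    (fun k => Pi.single k.1 (u k.1 k.2)) (fun k => s k.1 k.2)
    (fun k => Pi.single k.1 (v k.1 k.2)) c
  refine ⟨f, r, fun x => funext fun i => ?_⟩
  rw [h, Fintype.sum_sigma, reluSum, Fintype.sum_eq_single i]
  · simp
  · intro j hj
    simp [Pi.single_eq_of_ne hj.symm]

/-! ### From full branches to linear regions -/

/-- Finitely many affine maps can be told apart by a single linear functional of their values. -/
theorem exists_dotProduct_ne {d : ℕ} {E ι : Type*} [AddCommGroup E] [Module ℝ E] [Finite ι]
    {A : ι → E →ᵃ[ℝ] (Fin d → ℝ)} (hA : Function.Injective A) :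
    ∃ ω : Fin d → ℝ, ∀ i j, i ≠ j → ∃ x, ω ⬝ᵥ A i x ≠ ω ⬝ᵥ A j x := by
  have hne (z : {z : ι × ι // z.1 ≠ z.2}) : ∃ x, A z.1.1 x - A z.1.2 x ≠ 0 := by
    by_contra! h
    exact z.2 (hA (AffineMap.ext fun x => sub_eq_zero.1 (h x)))
  choose x hx using hne
  obtain ⟨f, hf⟩ := Module.exists_dual_forall_apply_ne_zero (K := ℝ) _ hx
  refine ⟨(dotProductEquiv ℝ (Fin d)).symm f, fun i j hij => ⟨x ⟨(i, j), hij⟩, fun h => ?_⟩⟩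
  refine hf ⟨(i, j), hij⟩ ?_
  have hfd (y : Fin d → ℝ) : f y = (dotProductEquiv ℝ (Fin d)).symm f ⬝ᵥ y := by
    conv_lhs => rw [← (dotProductEquiv ℝ (Fin d)).apply_symm_apply f]
    rfl
  rw [map_sub, hfd, hfd, h, sub_self]

/-- Full branches of `T`, a self-map of `ℝ^d`, give linear regions of a suitable affine function
of `T`, precomposed with the projection of `ℝ^k` to the first `d ≤ k` coordinates. -/
theorem exists_card_le_numLinearRegions_apply_comp {d k m : ℕ} (hd : d ≤ k) (hm : 1 ≤ m)
    {Q : Set (Fin d → ℝ)} (hQ : IsOpen Q) (hne : Q.Nonempty) {T : (Fin d → ℝ) → (Fin d → ℝ)}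
    {ι : Type*} [Fintype ι] {A : ι → (Fin d → ℝ) →ᵃ[ℝ] (Fin d → ℝ)} (hA : Function.Injective A)
    (hT : ∀ i, IsFullBranch Q T (A i)) :
    ∃ (g : AffineLayer d m) (f : AffineLayer k d),
      (Fintype.card ι : ℕ∞) ≤ numLinearRegions (g.apply ∘ T ∘ f.apply) := by
  obtain ⟨ω, hω⟩ := exists_dotProduct_ne hA
  let π : (Fin k → ℝ) →ₗ[ℝ] (Fin d → ℝ) := LinearMap.funLeft ℝ ℝ (Fin.castLE hd)
  have hπ : Function.Surjective π :=
    LinearMap.funLeft_surjective_of_injective ℝ ℝ _ (Fin.castLE_injective hd)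
  let g : AffineLayer d m := ⟨fun _ => ω, 0⟩
  let f : AffineLayer k d := ⟨LinearMap.toMatrix' π, 0⟩
  have hf (x) : f.apply x = π x := by
    simp [f, AffineLayer.apply]
  have hg (y) (l) : g.apply y l = ω ⬝ᵥ y := by
    simp [g, AffineLayer.apply, Matrix.mulVec]
  let G : (Fin d → ℝ) →ᵃ[ℝ] (Fin m → ℝ) := (Matrix.mulVecLin g.W).toAffineMap
  have hG (y) : G y = g.apply y := by simp [G, AffineLayer.apply, show g.b = 0 from rfl]
  refine ⟨g, f, card_le_numLinearRegions
    (A := fun i => G.comp ((A i).comp π.toAffineMap)) (fun i j hij => ?_) fun i => ?_⟩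
  · by_contra hne
    obtain ⟨y, hy⟩ := hω i j hne
    obtain ⟨x, rfl⟩ := hπ y
    have := congr_fun (DFunLike.congr_fun hij x) ⟨0, hm⟩
    simp only [AffineMap.comp_apply, hG, hg] at this
    exact hy this
  · have hopen : IsOpen ((fun x => A i (π x)) ⁻¹' Q) :=
      hQ.preimage ((A i).continuous_of_finiteDimensional.comp π.continuous_of_finiteDimensional)
    obtain ⟨q, hq⟩ := hne
    obtain ⟨y, rfl⟩ := (hT i).1 q
    obtain ⟨x, rfl⟩ := hπ y
    refine ⟨x, mem_interior.2 ⟨_, fun z hz => ?_, hopen, hq⟩⟩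
    have hz : A i (π z) ∈ Q := hz
    simp [hf, hG, ((hT i).2 _ hz).2]

/-- Folding `d ≤ k` of the `k` coordinates, the `i`-th one with `p i` units of each layer,
contributes a factor `∏ i, foldCount (p i)` to the number of regions in every layer. -/
theorem exists_pow_le_numLinearRegions {d k m n : ℕ} (hd : d ≤ k) (hm : 1 ≤ m) {p : Fin d → ℕ}
    (hp : ∑ i, p i ≤ n) (L : ℕ) :
    ∃ N : RectifierNetwork k (List.replicate L n) m,
      (((∏ i, foldCount (p i)) ^ L : ℕ) : ℕ∞) ≤ numLinearRegions N.eval := by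
  choose u s v c B hB hBF using fun i => exists_reluSum_isFullBranch (p i)
  obtain ⟨f, r, hT⟩ := exists_affineLayer_apply_rectifier_eq_reluSum hp u s v c
  obtain ⟨C, hC, hCF⟩ := exists_isFullBranch_pi hB hBF
  have hQ : IsOpen (Set.univ.pi fun _ : Fin d => Set.Ioo (0 : ℝ) 1) :=
    isOpen_set_pi Set.finite_univ fun _ _ => isOpen_Ioo
  have hne : (Set.univ.pi fun _ : Fin d => Set.Ioo (0 : ℝ) 1).Nonempty :=
    Set.univ_pi_nonempty_iff.2 fun _ => Set.nonempty_Ioo.2 one_pos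
  obtain ⟨A, hA, hAF⟩ := exists_isFullBranch_iterate hQ hne hC hCF L
  obtain ⟨g, π, hgπ⟩ := exists_card_le_numLinearRegions_apply_comp hd hm hQ hne hA hAF
  obtain ⟨N, hN⟩ := RectifierNetwork.exists_eval_eq_iterate f r hT g L
  obtain ⟨N', hN'⟩ := N.exists_eval_eq_comp_apply π
  refine ⟨N', ?_⟩
  rw [hN', hN]
  simpa [Function.comp_assoc] using hgπ

/-! ### Distributing the units over the coordinates -/

theorem one_sub_div_pow_le {a t : ℕ} (ht : t ≠ 0) (hat : a ≤ t) :
    (1 - (a : ℝ) / t) ^ t * 2 ^ a ≤ 1 := by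
  have ht' : (0 : ℝ) < t := by positivity
  have h1 : (1 - (a : ℝ) / t) ^ t ≤ Real.exp (-a) := by
    have h := pow_le_pow_left₀ (sub_nonneg.2 ((div_le_one ht').2 (by exact_mod_cast hat)))
      (Real.one_sub_le_exp_neg ((a : ℝ) / t)) t
    rwa [← Real.exp_nat_mul, mul_neg, mul_div_cancel₀ _ ht'.ne'] at h
  have h2 : (2 : ℝ) ^ a ≤ Real.exp a := by
    have h := pow_le_pow_left₀ (by norm_num) (Real.add_one_le_exp (1 : ℝ)) a
    rw [← Real.exp_nat_mul, mul_one] at h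
    norm_num at h
    exact h
  calc (1 - (a : ℝ) / t) ^ t * 2 ^ a ≤ Real.exp (-a) * Real.exp a := by gcongr
    _ = 1 := by rw [← Real.exp_add, neg_add_cancel, Real.exp_zero]

theorem one_add_div_pow_le {r t : ℕ} (ht : t ≠ 0) :
    (1 + (r : ℝ) / (2 * t)) ^ t ≤ 2 ^ r := by
  have ht' : (0 : ℝ) < t := by positivity
  have h1 : (1 + (r : ℝ) / (2 * t)) ^ t ≤ Real.exp (r * (1 / 2)) := by
    have h := pow_le_pow_left₀ (by positivity)
      ((add_comm _ _).trans_le (Real.add_one_le_exp ((r : ℝ) / (2 * t)))) t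
    rw [← Real.exp_nat_mul] at h
    rwa [show (t : ℝ) * (r / (2 * t)) = r * (1 / 2) by field_simp] at h
  have h2 : Real.exp (1 / 2) ≤ 2 := by
    have h := Real.one_sub_le_exp_neg (1 / 2)
    rw [Real.exp_neg] at h
    have := Real.exp_pos (1 / 2)
    field_simp at h
    linarith
  rw [Real.exp_nat_mul] at h1
  exact h1.trans (by gcongr)

/-- With `d` coordinates of which `r` get three units and the others get two. -/
theorem exists_sum_eq_prod_foldCount_eq {d r : ℕ} (hr : r ≤ d) :
    ∃ p : Fin d → ℕ, ∑ i, p i = 2 * d + r ∧ ∏ i, foldCount (p i) = 2 ^ (d + r) := by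
  obtain ⟨e, rfl⟩ := Nat.exists_eq_add_of_le' hr
  refine ⟨Fin.append (fun _ : Fin e => 2) (fun _ : Fin r => 3), ?_, ?_⟩
  · rw [Fin.sum_univ_add]
    simp
    ring
  · rw [Fin.prod_univ_add]
    simp [foldCount]
    rw [show 4 = 2 ^ 2 from rfl, ← pow_mul, ← pow_add]
    congr 1
    ring

/-- The average of `n / t` units per coordinate need not be an integer. If it is, or if it is at
least three, `⌊n / t⌋` units for each of the `t` coordinates suffice, since three or more units give
an additional fold. Otherwise two or three units are given to as many coordinates as possible, and
the remaining coordinates are ignored. -/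
theorem exists_le_prod_foldCount {t n : ℕ} (ht : 1 ≤ t) (hn : t ≤ n) :
    ∃ (d : ℕ) (p : Fin d → ℕ), d ≤ t ∧ ∑ i, p i ≤ n ∧
      ((n : ℝ) / t) ^ t ≤ ((∏ i, foldCount (p i) : ℕ) : ℝ) := by
  have ht' : (0 : ℝ) < t := by exact_mod_cast ht
  by_cases hq : t ∣ n ∨ 3 * t ≤ n
  · refine ⟨t, fun _ => n / t, le_rfl, by simpa using Nat.mul_div_le n t, ?_⟩
    simp only [Finset.prod_const, Finset.card_univ, Fintype.card_fin, Nat.cast_pow]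
    gcongr
    rcases hq with ⟨q, rfl⟩ | hq
    · rw [Nat.mul_div_cancel_left _ ht, Nat.cast_mul, mul_div_cancel_left₀ _ ht'.ne']
      unfold foldCount
      split_ifs <;> simp
    · have h3 : 3 ≤ n / t := (Nat.le_div_iff_mul_le ht).2 hq
      rw [foldCount, if_neg (by omega), Nat.cast_succ, ← Nat.floor_div_eq_div (K := ℝ)]
      exact (Nat.lt_floor_add_one _).le
  push Not at hq
  have hnt : n ≠ t := by rintro rfl; exact hq.1 dvd_rfl
  rcases le_total (2 * t) n with h2 | h2
  · obtain ⟨r, rfl⟩ := Nat.exists_eq_add_of_le h2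
    obtain ⟨p, hp, hp'⟩ := exists_sum_eq_prod_foldCount_eq (d := t) (r := r) (by omega)
    refine ⟨t, p, le_rfl, hp.le, ?_⟩
    rw [hp', pow_add]
    push_cast
    calc ((2 * t + r : ℝ) / t) ^ t = 2 ^ t * (1 + (r : ℝ) / (2 * t)) ^ t := by
          rw [← mul_pow]; congr 1; field_simp
      _ ≤ 2 ^ t * 2 ^ r := by gcongr; exact one_add_div_pow_le (by omega)
  · obtain ⟨p, hp, hp'⟩ := exists_sum_eq_prod_foldCount_eq (d := n / 2) (r := n % 2) (by omega)
    refine ⟨n / 2, p, by omega, by omega, ?_⟩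
    rw [hp']
    -- `e` is `n / 2` rounded up
    obtain ⟨a, ha⟩ : ∃ a, n / 2 + n % 2 + a = t := Nat.exists_eq_add_of_le (by omega) |>.imp
      fun _ => Eq.symm
    set e := n / 2 + n % 2
    have hne : n ≤ 2 * e := by omega
    have hea : (e : ℝ) / t = 1 - a / t := by
      rw [← ha] at ht' ⊢
      push_cast at ht' ⊢
      field_simp
      ring
    push_cast
    calc ((n : ℝ) / t) ^ t ≤ (2 * ((e : ℝ) / t)) ^ t := by
          rw [← mul_div_assoc]; gcongr; exact_mod_cast hne
      _ = 2 ^ e * ((1 - (a : ℝ) / t) ^ t * 2 ^ a) := by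
          rw [hea, mul_pow, show (2 : ℝ) ^ t = 2 ^ e * 2 ^ a by rw [← pow_add, ha]]; ring
      _ ≤ 2 ^ e * 1 := by gcongr; exact one_sub_div_pow_le (by omega) (by omega)
      _ = 2 ^ e := mul_one _

/-! ### The lower bound -/

theorem mainTheorem2 (n₀ : ℕ) (hn₀ : 1 ≤ n₀) :
    ∃ c : ℝ, 0 < c ∧
      ∀ L : ℕ, 1 ≤ L → ∀ n : ℕ, n₀ ≤ n → ∀ m : ℕ, 1 ≤ m →
        ∃ N : RectifierNetwork n₀ (List.replicate L n) m,
          ENNReal.ofReal (c * (((n : ℝ) / (n₀ : ℝ)) ^ ((L - 1) * n₀) * (n : ℝ) ^ n₀))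
            ≤ (numLinearRegions N.eval : ℝ≥0∞) := by
  have h0 : (0 : ℝ) < n₀ := by exact_mod_cast hn₀
  refine ⟨((n₀ : ℝ) ^ n₀)⁻¹, by positivity, fun L hL n hn m hm => ?_⟩
  obtain ⟨d, p, hd, hp, hK⟩ := exists_le_prod_foldCount hn₀ hn
  obtain ⟨N, hN⟩ := exists_pow_le_numLinearRegions hd hm hp L
  refine ⟨N, le_trans ?_ (ENat.toENNReal_le.2 hN)⟩
  rw [ENat.toENNReal_coe, ← ENNReal.ofReal_natCast]
  refine ENNReal.ofReal_le_ofReal ?_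
  -- the last factor `n ^ n₀` is `n₀ ^ n₀` times one more factor `(n / n₀) ^ n₀`
  calc ((n₀ : ℝ) ^ n₀)⁻¹ * (((n : ℝ) / n₀) ^ ((L - 1) * n₀) * (n : ℝ) ^ n₀)
      = (((n : ℝ) / n₀) ^ n₀) ^ L := by
        obtain ⟨l, rfl⟩ := Nat.exists_eq_add_of_le' hL
        rw [Nat.add_sub_cancel, pow_succ _ l, ← pow_mul, mul_comm l, div_pow (n : ℝ) _ n₀]
        ring
    _ ≤ (((∏ i, foldCount (p i)) ^ L : ℕ) : ℝ) := by
        rw [Nat.cast_pow]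
        gcongr
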